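/- Let $I=[0,1)$ with Lebesgue measure, let $n\ge 0$, and let $\mathbb P_0,\mathbb P_1,\dots,\mathbb P_n$ be equivalent probability measures on a measurable space $(\Omega,\mathcal F)$ (each has the same null sets), with $\mathbb P_0$ standard. All probability spaces, including products, carry the completion of their measure. A map $\phi:(\Omega_1,\mu_1)\to(\Omega_2,\mu_2)$ is a mod $0$ isomorphism if there are subsets $\Omega_1'\subseteq\Omega_1$, $\Omega_2'\subseteq\Omega_2$ of full measure such that $\phi$ restricts to a bijection $\Omega_1'\to\Omega_2'$ that is measurable and measure preserving together with its inverse. A probability measure is standard if it is mod $0$ isomorphic to Lebesgue measure on $[0,1]$, to a probability measure on finitely or countably many atoms, or to a convex combination of both. Then there is a unique Borel probability measure $\mathbb P_0'$ on $\Omega'=(0,\infty)^n$ (identified with its completion) for which there exists a mod $0$ isomorphism $\phi:\Omega\times I\to\Omega'\times I$ from $\mathbb P_0\times I$ to $\mathbb P_0'\times I$ which is, for every $i=1,\dots,n$, also a mod $0$ isomorphism from $\mathbb P_i\times I$ to $\mathbb P_i'\times I$, where \[ \mathbb P_i'(A)=\int_{(0,\infty)^n}\omega_i\,1_A(\omega)\,\mathrm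 d\mathbb P_0'(\omega) \] and $\omega_i$ is the $i$-th coordinate function. Moreover, $\mathbb P_0'$ is the law under $\mathbb P_0$ of the vector of Radon--Nikodym derivatives $\left(\frac{\mathrm d\mathbb P_1}{\mathrm d\mathbb P_0},\dots,\frac{\mathrm d\mathbb P_n}{\mathrm d\mathbb P_0}\right)$, and for each $i$ the function $\omega_i$ is $\mathbb P_0'$-integrable with $\mathbb E_{\mathbb P_0'}(\omega_i)=1$, so that $\mathbb P_i'$ is a probability measure. -/

import Mathlib

open MeasureTheory
open scoped ENNReal

/-- The map `φ` is an isomorphism mod 0 from `(α, μ)` to `(β, ν)`, both carrying the Lebesgue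
extension (completion) of their measure: there are subspaces `s` and `t` of full measure such that
`φ` restricts to a bijection from `s` to `t`, the restriction is a homomorphism (measurable and
measure preserving), and so is its inverse.  The measurable sets of the completions are the
`NullMeasurableSet`s; if `μ` and `ν` are complete these are just the measurable sets. -/
def IsModZeroIso {α β : Type*} [MeasurableSpace α] [MeasurableSpace β]
    (μ : Measure α) (ν : Measure β) (φ : α → β) : Prop :=
  ∃ (s : Set α) (t : Set β), μ sᶜ = 0 ∧ ν tᶜ = 0 ∧ Set.BijOn φ s t ∧
    (∀ U ⊆ t, NullMeasurableSet U ν →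
      NullMeasurableSet (s ∩ φ ⁻¹' U) μ ∧ μ (s ∩ φ ⁻¹' U) = ν U) ∧
    (∀ V ⊆ s, NullMeasurableSet V μ →
      NullMeasurableSet (φ '' V) ν ∧ ν (φ '' V) = μ V)

/-- Lebesgue measure on `[0,1]` with total weight `a`, together with countably many
atoms of weights `m 0, m 1, …` (atoms of weight `0` are negligible). -/
noncomputable def lebesgueWithAtoms (a : ℝ≥0∞) (m : ℕ → ℝ≥0∞) :
    Measure (Set.Icc (0 : ℝ) 1 ⊕ ℕ) :=
  a • ((volume : Measure ℝ).comap (Subtype.val : Set.Icc (0 : ℝ) 1 → ℝ)).map Sum.inl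
    + Measure.sum (fun k => m k • Measure.dirac (Sum.inr k))

/-- A probability measure is standard if it is isomorphic mod 0 to Lebesgue measure on `[0,1]`
(`a = 1`), to a finite or countable collection of atoms (`a = 0`), or to a convex
combination of both. -/
def IsStandardProb {Ω : Type*} [MeasurableSpace Ω] (μ : Measure Ω) : Prop :=
  ∃ (a : ℝ≥0∞) (m : ℕ → ℝ≥0∞), a + ∑' k, m k = 1 ∧
    ∃ φ : Ω → Set.Icc (0 : ℝ) 1 ⊕ ℕ, IsModZeroIso μ (lebesgueWithAtoms a m) φ

/-- The product of `μ` with Lebesgue measure on `I = [0,1)`. -/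
noncomputable def withCasino {Ω : Type*} [MeasurableSpace Ω] (μ : Measure Ω) :
    Measure (Ω × Set.Ico (0 : ℝ) 1) :=
  μ.prod ((volume : Measure ℝ).comap (Subtype.val : Set.Ico (0 : ℝ) 1 → ℝ))

/-- The space `(0,∞)^n`. -/
abbrev PosOrthant (n : ℕ) : Type := Fin n → Set.Ioi (0 : ℝ)

/-- The measure `A ↦ ∫ ω_i 1_A(ω) dμ` on `(0,∞)^n`. -/
noncomputable def coordMeasure {n : ℕ} (μ : Measure (PosOrthant n)) (i : Fin n) :
    Measure (PosOrthant n) :=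
  μ.withDensity (fun ω => ENNReal.ofReal (ω i : ℝ))

/-- A single map `φ : Ω × I → (0,∞)^n × I` is an isomorphism mod 0 from `P₀ × I` to
`ν × I` and, for each `i`, also from `P i × I` to `ν_i × I`, where `ν_i` has density the
`i`-th coordinate function with respect to `ν`. -/
def JointlyModZeroIsomorphic {Ω : Type*} [MeasurableSpace Ω] {n : ℕ}
    (P₀ : Measure Ω) (P : Fin n → Measure Ω) (ν : Measure (PosOrthant n)) : Prop :=
  ∃ φ : Ω × Set.Ico (0 : ℝ) 1 → PosOrthant n × Set.Ico (0 : ℝ) 1,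
    IsModZeroIso (withCasino P₀) (withCasino ν) φ ∧
    ∀ i, IsModZeroIso (withCasino (P i)) (withCasino (coordMeasure ν i)) φ

/-! Let `D` be the vector of densities of the `P i` with respect to `P₀`. For existence,
disintegrate `P₀ × I` over `D`. Each conditional law is the product of a conditional law of `P₀`
with Lebesgue measure, hence atomless. After an embedding into the line, its distribution function
carries it to the uniform law on `[0,1)`, injectively off a null set. Keeping `D` as first
coordinate and this value as second gives an isomorphism onto `law(D) × I`
(`exists_isModZeroIso_fst_eq`). All densities are functions of the first coordinate, so the same map
also carries each `P i × I` to its target.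

For uniqueness, a map that is an isomorphism for both a measure and its reweighting must match the
densities almost everywhere (`IsModZeroIso.ae_eq_comp_of_withDensity`). Thus the first coordinate of
any joint isomorphism is almost everywhere `D`, and `ν` must be the law of `D`. -/

open Set Filter ProbabilityTheory

/-! ### Mod 0 isomorphisms as pairs of almost everywhere inverse maps. -/

section NullMeasurePreserving

variable {α β γ : Type*} [MeasurableSpace α] [MeasurableSpace β] [MeasurableSpace γ]
  {μ : Measure α} {ν : Measure β} {ρ : Measure γ}

/-- A map that is measurable and measure preserving between the completions of `μ` and `ν`. -/
structure NullMeasurePreserving (f : α → β) (μ : Measure α) (ν : Measure β) : Prop where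
  nullMeasurable : NullMeasurable f μ
  measure_preimage : ∀ ⦃U : Set β⦄, MeasurableSet U → μ (f ⁻¹' U) = ν U

namespace NullMeasurePreserving

theorem preimage_null {f : α → β} (hf : NullMeasurePreserving f μ ν) {U : Set β} (hU : ν U = 0) :
    μ (f ⁻¹' U) = 0 := by
  refine measure_mono_null (preimage_mono (subset_toMeasurable ν U)) ?_
  rw [hf.measure_preimage (measurableSet_toMeasurable ν U), measure_toMeasurable, hU]

theorem tendsto_ae {f : α → β} (hf : NullMeasurePreserving f μ ν) : Tendsto f (ae μ) (ae ν) :=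
  fun _ hU => hf.preimage_null hU

theorem preimage_ae_eq {f : α → β} (hf : NullMeasurePreserving f μ ν) {U V : Set β}
    (h : U =ᵐ[ν] V) : (f ⁻¹' U : Set α) =ᵐ[μ] (f ⁻¹' V : Set α) :=
  hf.tendsto_ae.eventually h

theorem nullMeasurableSet_preimage {f : α → β} (hf : NullMeasurePreserving f μ ν) {U : Set β}
    (hU : NullMeasurableSet U ν) : NullMeasurableSet (f ⁻¹' U) μ := by
  obtain ⟨V, hV, hUV⟩ := hU
  exact (hf.nullMeasurable hV).congr (hf.preimage_ae_eq hUV).symm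

theorem measure_preimage₀ {f : α → β} (hf : NullMeasurePreserving f μ ν) {U : Set β}
    (hU : NullMeasurableSet U ν) : μ (f ⁻¹' U) = ν U := by
  obtain ⟨V, hV, hUV⟩ := hU
  rw [measure_congr (hf.preimage_ae_eq hUV), hf.measure_preimage hV, measure_congr hUV]

theorem comp {f : α → β} {g : β → γ} (hg : NullMeasurePreserving g ν ρ)
    (hf : NullMeasurePreserving f μ ν) : NullMeasurePreserving (g ∘ f) μ ρ where
  nullMeasurable _ hU := hf.nullMeasurableSet_preimage (hg.nullMeasurable hU)
  measure_preimage U hU := by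
    rw [preimage_comp, hf.measure_preimage₀ (hg.nullMeasurable hU), hg.measure_preimage hU]

theorem of_map_eq {f : α → β} (hf : AEMeasurable f μ) (h : μ.map f = ν) :
    NullMeasurePreserving f μ ν where
  nullMeasurable := hf.nullMeasurable
  measure_preimage U hU := by rw [← h, Measure.map_apply_of_aemeasurable hf hU]

theorem aemeasurable [MeasurableSpace.CountablyGenerated β] {f : α → β}
    (hf : NullMeasurePreserving f μ ν) : AEMeasurable f μ :=
  hf.nullMeasurable.aemeasurable

theorem map_eq [MeasurableSpace.CountablyGenerated β] {f : α → β}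
    (hf : NullMeasurePreserving f μ ν) : μ.map f = ν := by
  ext U hU
  rw [Measure.map_apply_of_aemeasurable hf.aemeasurable hU, hf.measure_preimage hU]

/-- An a.e. inverse of a null measure preserving map is null measure preserving as soon as it is
null measurable. -/
theorem symm {f : α → β} {g : β → α} (hf : NullMeasurePreserving f μ ν)
    (hg : NullMeasurable g ν) (h : ∀ᵐ x ∂μ, g (f x) = x) : NullMeasurePreserving g ν μ where
  nullMeasurable := hg
  measure_preimage V hV := by
    rw [← hf.measure_preimage₀ (hg hV), ← preimage_comp]
    refine measure_congr ?_
    filter_upwards [h] with x hx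
    change (g (f x) ∈ V) = (x ∈ V)
    rw [hx]

/-- The product with the identity of a probability space is null measure preserving. -/
theorem prodMap_id [IsProbabilityMeasure μ] [IsProbabilityMeasure ν] [IsProbabilityMeasure ρ]
    {f : α → β} (hf : NullMeasurePreserving f μ ν) :
    NullMeasurePreserving (Prod.map f id) (μ.prod ρ) (ν.prod ρ) := by
  have hfst : NullMeasurePreserving (Prod.fst : α × γ → α) (μ.prod ρ) μ :=
    .of_map_eq measurable_fst.aemeasurable (by simp)
  have h1 : NullMeasurable (Prod.map f id) (μ.prod ρ) := by
    have h2 : NullMeasurable (f ∘ (Prod.fst : α × γ → α)) (μ.prod ρ) :=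
      (hf.comp hfst).nullMeasurable
    have h3 : NullMeasurable (Prod.snd : α × γ → γ) (μ.prod ρ) := measurable_snd.nullMeasurable
    exact Measurable.prodMk h2.measurable' h3.measurable'
  refine ⟨h1, ?_⟩
  -- `Prod.map f id` is measurable only for the completed σ-algebra, so the image measure is formed
  -- from there; it is then identified on rectangles.
  let m : Measure (β × γ) :=
    Measure.map (α := NullMeasurableSpace (α × γ) (μ.prod ρ)) (Prod.map f id) (μ.prod ρ).completion
  have hm : ∀ U, MeasurableSet U → m U = μ.prod ρ (Prod.map f id ⁻¹' U) := fun U hU =>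
    Measure.map_apply (α := NullMeasurableSpace (α × γ) (μ.prod ρ)) h1.measurable' hU
  have key : m = ν.prod ρ := by
    refine (Measure.prod_eq fun s t hs ht => ?_).symm
    rw [hm _ (hs.prod ht), ← hf.measure_preimage hs, ← Measure.prod_prod]
    rfl
  intro U hU
  rw [← hm U hU, key]

end NullMeasurePreserving

/-- Trades the full-measure subsets for an everywhere defined inverse up to null sets, which makes
composition and products formal. Conversely, the points fixed by `ψ ∘ φ` and by `φ ∘ ψ` are
automatically in bijection. -/
theorem isModZeroIso_iff [Nonempty α] {φ : α → β} :
    IsModZeroIso μ ν φ ↔ ∃ ψ : β → α, NullMeasurePreserving φ μ ν ∧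
      NullMeasurePreserving ψ ν μ ∧ (∀ᵐ x ∂μ, ψ (φ x) = x) ∧ ∀ᵐ y ∂ν, φ (ψ y) = y := by
  constructor
  · rintro ⟨s, t, hs, ht, hbij, hφ, hψ⟩
    have hsae : s =ᵐ[μ] (univ : Set α) := ae_eq_univ.2 hs
    have htae : t =ᵐ[ν] (univ : Set β) := ae_eq_univ.2 ht
    have hsn : NullMeasurableSet s μ := nullMeasurableSet_univ.congr hsae.symm
    have htn : NullMeasurableSet t ν := nullMeasurableSet_univ.congr htae.symm
    have hinv : InvOn (Function.invFunOn φ s) φ s t := hbij.invOn_invFunOn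
    refine ⟨Function.invFunOn φ s, ?_, ?_, ?_, ?_⟩
    · have key : ∀ U, MeasurableSet U → NullMeasurableSet (φ ⁻¹' U) μ ∧ μ (φ ⁻¹' U) = ν U := by
        intro U hU
        have h := hφ (U ∩ t) inter_subset_right (hU.nullMeasurableSet.inter htn)
        have e1 : s ∩ φ ⁻¹' (U ∩ t) = φ ⁻¹' U ∩ s := by
          ext x
          exact ⟨fun hx => ⟨hx.2.1, hx.1⟩, fun hx => ⟨hx.2, hx.1, hbij.mapsTo hx.2⟩⟩
        have e2 : (φ ⁻¹' U ∩ s : Set α) =ᵐ[μ] φ ⁻¹' U :=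
          inter_ae_eq_left_of_ae_eq_univ hsae
        have e3 : (U ∩ t : Set β) =ᵐ[ν] U := inter_ae_eq_left_of_ae_eq_univ htae
        rw [e1] at h
        exact ⟨h.1.congr e2, by rw [← measure_congr e2, h.2, measure_congr e3]⟩
      exact ⟨fun U hU => (key U hU).1, fun U hU => (key U hU).2⟩
    · have key : ∀ V, MeasurableSet V → NullMeasurableSet (Function.invFunOn φ s ⁻¹' V) ν ∧
          ν (Function.invFunOn φ s ⁻¹' V) = μ V := by
        intro V hV
        have h := hψ (V ∩ s) inter_subset_right (hV.nullMeasurableSet.inter hsn)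
        have e1 : φ '' (V ∩ s) = Function.invFunOn φ s ⁻¹' V ∩ t := by
          ext y
          constructor
          · rintro ⟨x, ⟨hxV, hxs⟩, rfl⟩
            exact ⟨by rw [mem_preimage, hinv.1 hxs]; exact hxV, hbij.mapsTo hxs⟩
          · rintro ⟨hyV, hyt⟩
            exact ⟨_, ⟨hyV, hbij.surjOn.mapsTo_invFunOn hyt⟩, hinv.2 hyt⟩
        have e2 : (Function.invFunOn φ s ⁻¹' V ∩ t : Set β) =ᵐ[ν] Function.invFunOn φ s ⁻¹' V :=
          inter_ae_eq_left_of_ae_eq_univ htae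
        have e3 : (V ∩ s : Set α) =ᵐ[μ] V := inter_ae_eq_left_of_ae_eq_univ hsae
        rw [e1] at h
        exact ⟨h.1.congr e2, by rw [← measure_congr e2, h.2, measure_congr e3]⟩
      exact ⟨fun V hV => (key V hV).1, fun V hV => (key V hV).2⟩
    · exact measure_mono_null (fun x hx hxs => hx (hinv.1 hxs)) hs
    · exact measure_mono_null (fun y hy hyt => hy (hinv.2 hyt)) ht
  · rintro ⟨ψ, hφ, hψ, h1, h2⟩
    have hs : {x | ψ (φ x) = x} =ᵐ[μ] (univ : Set α) := ae_eq_univ.2 h1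
    have ht : {y | φ (ψ y) = y} =ᵐ[ν] (univ : Set β) := ae_eq_univ.2 h2
    refine ⟨{x | ψ (φ x) = x}, {y | φ (ψ y) = y}, h1, h2, ⟨?_, ?_, ?_⟩, ?_, ?_⟩
    · intro x hx
      exact congrArg φ hx
    · intro x hx y hy hxy
      rw [← hx, ← hy, hxy]
    · intro y hy
      exact ⟨ψ y, congrArg ψ hy, hy⟩
    · intro U _ hU
      have e : ({x | ψ (φ x) = x} ∩ φ ⁻¹' U : Set α) =ᵐ[μ] φ ⁻¹' U :=
        inter_ae_eq_right_of_ae_eq_univ hs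
      exact ⟨(hφ.nullMeasurableSet_preimage hU).congr e.symm,
        by rw [measure_congr e, hφ.measure_preimage₀ hU]⟩
    · intro V hVs hV
      have e1 : φ '' V = {y | φ (ψ y) = y} ∩ ψ ⁻¹' V := by
        ext y
        constructor
        · rintro ⟨x, hx, rfl⟩
          exact ⟨congrArg φ (hVs hx), by rw [mem_preimage, hVs hx]; exact hx⟩
        · rintro ⟨hy, hyV⟩
          exact ⟨ψ y, hyV, hy⟩
      have e : ({y | φ (ψ y) = y} ∩ ψ ⁻¹' V : Set β) =ᵐ[ν] ψ ⁻¹' V :=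
        inter_ae_eq_right_of_ae_eq_univ ht
      rw [e1]
      exact ⟨(hψ.nullMeasurableSet_preimage hV).congr e.symm,
        by rw [measure_congr e, hψ.measure_preimage₀ hV]⟩

theorem IsModZeroIso.comp [Nonempty α] {φ : α → β} {χ : β → γ} (hχ : IsModZeroIso ν ρ χ)
    (hφ : IsModZeroIso μ ν φ) : IsModZeroIso μ ρ (χ ∘ φ) := by
  have : Nonempty β := ‹Nonempty α›.map φ
  obtain ⟨ψ, h1, h2, h3, h4⟩ := isModZeroIso_iff.1 hφ
  obtain ⟨ω, k1, k2, k3, k4⟩ := isModZeroIso_iff.1 hχ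
  refine isModZeroIso_iff.2 ⟨ψ ∘ ω, k1.comp h1, h2.comp k2, ?_, ?_⟩
  · filter_upwards [h3, h1.tendsto_ae.eventually k3] with x hx hx'
    simp [hx, hx']
  · filter_upwards [k4, k2.tendsto_ae.eventually h4] with x hx hx'
    simp [hx, hx']

instance : IsProbabilityMeasure
    ((volume : Measure ℝ).comap (Subtype.val : Set.Ico (0 : ℝ) 1 → ℝ)) :=
  ⟨by rw [comap_subtype_coe_apply measurableSet_Ico, image_univ, Subtype.range_coe, Real.volume_Ico]; simp⟩

instance [IsProbabilityMeasure μ] : IsProbabilityMeasure (withCasino μ) := by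
  unfold withCasino; infer_instance

theorem IsModZeroIso.prodMap_id [IsProbabilityMeasure μ] [IsProbabilityMeasure ν] {φ : α → β}
    (hφ : IsModZeroIso μ ν φ) :
    IsModZeroIso (withCasino μ) (withCasino ν) (Prod.map φ id) := by
  have : Nonempty α := nonempty_of_isProbabilityMeasure μ
  obtain ⟨ψ, h1, h2, h3, h4⟩ := isModZeroIso_iff.1 hφ
  have : Nonempty (Ico (0 : ℝ) 1) := ⟨0, by simp⟩
  refine isModZeroIso_iff.2 ⟨Prod.map ψ id, h1.prodMap_id, h2.prodMap_id, ?_, ?_⟩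
  · filter_upwards [Measure.quasiMeasurePreserving_fst.ae h3] with x hx
    exact Prod.ext hx rfl
  · filter_upwards [Measure.quasiMeasurePreserving_fst.ae h4] with x hx
    exact Prod.ext hx rfl

/-- A measurable measure preserving map that is injective on a set of full measure in a standard
Borel space is an isomorphism mod 0. -/
theorem IsModZeroIso.of_injOn [StandardBorelSpace α] [Nonempty α]
    [MeasurableSpace.CountablySeparated β]
    {φ : α → β} (hφ : MeasurePreserving φ μ ν) {s : Set α} (hs : MeasurableSet s)
    (hs0 : μ sᶜ = 0) (hinj : InjOn φ s) : IsModZeroIso μ ν φ := by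
  -- Lusin–Souslin: injective measurable images of Borel sets are measurable. This is what makes the
  -- inverse measurable.
  have him : ∀ V, MeasurableSet V → MeasurableSet (φ '' (V ∩ s)) := fun V hV =>
    (hV.inter hs).image_of_measurable_injOn hφ.measurable (hinj.mono inter_subset_right)
  have hinv := hinj.leftInvOn_invFunOn
  have ht : ν (φ '' s)ᶜ = 0 := by
    have hm : MeasurableSet (φ '' s) := by simpa using him univ MeasurableSet.univ
    rw [← hφ.measure_preimage hm.compl.nullMeasurableSet]
    exact measure_mono_null (fun x hx hxs => hx (mem_image_of_mem φ hxs)) hs0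
  have h1 : NullMeasurePreserving φ μ ν := .of_map_eq hφ.aemeasurable hφ.map_eq
  have h3 : ∀ᵐ x ∂μ, Function.invFunOn φ s (φ x) = x :=
    measure_mono_null (fun x hx hxs => hx (hinv hxs)) hs0
  refine isModZeroIso_iff.2 ⟨Function.invFunOn φ s, h1, h1.symm (fun V hV => ?_) h3, h3, ?_⟩
  · have e : (Function.invFunOn φ s ⁻¹' V ∩ φ '' s : Set β) =ᵐ[ν] Function.invFunOn φ s ⁻¹' V :=
      inter_ae_eq_left_of_ae_eq_univ (ae_eq_univ.2 ht)
    refine NullMeasurableSet.congr ?_ e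
    convert (him V hV).nullMeasurableSet using 1
    symm
    ext y
    constructor
    · rintro ⟨x, ⟨hxV, hxs⟩, rfl⟩
      exact ⟨by rw [mem_preimage, hinv hxs]; exact hxV, mem_image_of_mem φ hxs⟩
    · rintro ⟨hy, x, hxs, rfl⟩
      rw [mem_preimage, hinv hxs] at hy
      exact ⟨x, ⟨hy, hxs⟩, rfl⟩
  · have ht' : ∀ᵐ y ∂ν, y ∈ φ '' s := ht
    filter_upwards [ht'] with y hyt
    obtain ⟨x, hxs, rfl⟩ := hyt
    rw [hinv hxs]

end NullMeasurePreserving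

/-! ### Uniformizing atomless conditional laws by their distribution functions. -/

section ConditionalUniformization

/-- Serves to make the model space `[0,1] ⊕ ℕ` of a standard probability measure standard Borel. -/
instance Sum.instBorelSpace {α β : Type*} [TopologicalSpace α] [TopologicalSpace β]
    [MeasurableSpace α] [MeasurableSpace β] [BorelSpace α] [BorelSpace β] :
    BorelSpace (α ⊕ β) := by
  refine ⟨le_antisymm (fun s hs => ?_) (MeasurableSpace.generateFrom_le fun s hs => ?_)⟩
  · borelize (α ⊕ β)
    have hs' : MeasurableSet (Sum.inl ⁻¹' s : Set α) ∧ MeasurableSet (Sum.inr ⁻¹' s : Set β) := hs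
    have hl := Topology.IsOpenEmbedding.inl.measurableEmbedding (α := α) (β := α ⊕ β)
    have hr := Topology.IsOpenEmbedding.inr.measurableEmbedding (α := β) (β := α ⊕ β)
    have := (hl.measurableSet_image.2 hs'.1).union (hr.measurableSet_image.2 hs'.2)
    rwa [image_preimage_inl_union_image_preimage_inr] at this
  · exact ⟨(hs.preimage continuous_inl).measurableSet, (hs.preimage continuous_inr).measurableSet⟩

/-- The jump of the distribution function at a point is the mass of that point. -/
theorem continuous_cdf (μ : Measure ℝ) [IsProbabilityMeasure μ] [NullSingletonClass μ] :
    Continuous (cdf μ) := by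
  refine continuous_iff_continuousAt.2 fun x => ?_
  rw [(monotone_cdf μ).continuousAt_iff_leftLim_eq_rightLim, StieltjesFunction.rightLim_eq]
  have h := (cdf μ).measure_singleton x
  rw [measure_cdf, measure_singleton] at h
  exact le_antisymm ((monotone_cdf μ).leftLim_le le_rfl)
    (by linarith [ENNReal.ofReal_eq_zero.1 h.symm])

/-- Probability integral transform: for `0 ≤ c < 1`, a nonempty sublevel set of the distribution
function at height `c` is a half-line `Iic a`, and continuity forces the value `c` at `a`. -/
theorem map_cdf_eq_volume_restrict (μ : Measure ℝ) [IsProbabilityMeasure μ]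
    [NullSingletonClass μ] : μ.map (cdf μ) = volume.restrict (Ico 0 1) := by
  have hc := continuous_cdf μ
  refine Measure.ext_of_Iic _ _ fun c => ?_
  rw [Measure.map_apply hc.measurable measurableSet_Iic,
    Measure.restrict_apply measurableSet_Iic]
  rcases lt_or_ge c 0 with h0 | h0
  · have e1 : cdf μ ⁻¹' Iic c = ∅ :=
      eq_empty_of_forall_notMem fun y hy => (h0.trans_le (cdf_nonneg μ y)).not_ge hy
    have e2 : Iic c ∩ Ico (0 : ℝ) 1 = ∅ :=
      eq_empty_of_forall_notMem fun y hy => (h0.trans_le hy.2.1).not_ge hy.1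
    rw [e1, e2, measure_empty, measure_empty]
  rcases le_or_gt 1 c with h1 | h1
  · have e1 : cdf μ ⁻¹' Iic c = univ := eq_univ_of_forall fun y => (cdf_le_one μ y).trans h1
    have e2 : Iic c ∩ Ico (0 : ℝ) 1 = Ico 0 1 :=
      inter_eq_right.2 fun y hy => hy.2.le.trans h1
    rw [e1, e2]; simp
  have e2 : Iic c ∩ Ico (0 : ℝ) 1 = Icc 0 c := by
    ext y
    exact ⟨fun h => ⟨h.2.1, h.1⟩, fun h => ⟨h.2, h.1, h.2.trans_lt h1⟩⟩
  rw [e2, Real.volume_Icc, sub_zero]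
  rcases (cdf μ ⁻¹' Iic c).eq_empty_or_nonempty with he | hne
  · have : c ≤ 0 := ge_of_tendsto' (tendsto_cdf_atBot μ) fun y => by
      by_contra hy
      exact (eq_empty_iff_forall_notMem.1 he) y (not_le.1 hy).le
    rw [he, measure_empty, ENNReal.ofReal_of_nonpos this]
  · obtain ⟨b, hb⟩ := ((tendsto_cdf_atTop μ).eventually (lt_mem_nhds h1)).exists
    have hbdd : BddAbove (cdf μ ⁻¹' Iic c) := ⟨b, fun y hy => by
      by_contra hby
      exact (hb.trans_le (monotone_cdf μ (not_le.1 hby).le)).not_ge hy⟩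
    set a := sSup (cdf μ ⁻¹' Iic c) with ha
    have hac : cdf μ a ≤ c := (isClosed_Iic.preimage hc).csSup_mem hne hbdd
    have e1 : cdf μ ⁻¹' Iic c = Iic a := by
      ext y
      exact ⟨fun hy => le_csSup hbdd hy, fun hy => (monotone_cdf μ hy).trans hac⟩
    have hca : c ≤ cdf μ a := by
      refine ge_of_tendsto (hc.continuousWithinAt (s := Ioi a) (x := a)) ?_
      filter_upwards [self_mem_nhdsWithin] with y hy
      by_contra hyc
      exact (not_le.2 (mem_Ioi.1 hy)) (le_csSup hbdd (not_le.1 hyc).le)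
    rw [e1, ← ofReal_cdf, le_antisymm hac hca]

/-- The fractional part, as a map to `[0,1)`. -/
noncomputable def fractIco (x : ℝ) : Ico (0 : ℝ) 1 :=
  ⟨Int.fract x, Int.fract_nonneg x, Int.fract_lt_one x⟩

theorem measurable_fractIco : Measurable fractIco :=
  measurable_fract.subtype_mk

theorem map_fractIco :
    (volume.restrict (Ico (0 : ℝ) 1)).map fractIco = volume.comap Subtype.val := by
  ext A hA
  rw [Measure.map_apply measurable_fractIco hA,
    Measure.restrict_apply (measurable_fractIco hA),
    comap_subtype_coe_apply measurableSet_Ico]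
  congr 1
  ext x
  constructor
  · rintro ⟨hx, hx'⟩
    exact ⟨_, hx, Int.fract_eq_self.2 hx'⟩
  · rintro ⟨y, hy, rfl⟩
    have : fractIco y = y := Subtype.ext (Int.fract_eq_self.2 y.2)
    exact ⟨by rwa [mem_preimage, this], y.2⟩

theorem measurable_cdf_kernel {E : Type*} [MeasurableSpace E] (ξ : Kernel E ℝ)
    [IsMarkovKernel ξ] : Measurable fun p : E × ℝ => cdf (ξ p.1) p.2 := by
  have h : Measurable fun p : E × ℝ => (ξ.prodMkRight ℝ) p (Prod.mk p ⁻¹' {t | t.2 ≤ t.1.2}) :=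
    Kernel.measurable_kernel_prodMk_left
      (measurableSet_le measurable_snd (measurable_snd.comp measurable_fst))
  simp_rw [cdf_eq_real]
  exact h.ennreal_toReal

variable {X E : Type*} [MeasurableSpace X] [MeasurableSpace E]

/-- Disintegration along `D`: the factor `ρ` is independent of `D`, so it stays unchanged under
conditioning. -/
theorem map_prodMk_prod_eq_compProd [StandardBorelSpace X] [Nonempty X] {Y : Type*}
    [MeasurableSpace Y] (m : Measure X) [IsProbabilityMeasure m] (ρ : Measure Y)
    [IsProbabilityMeasure ρ] {D : X → E} (hD : Measurable D) :
    (m.prod ρ).map (fun z => (D z.1, z)) =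
      (m.map D) ⊗ₘ (condDistrib id D m ×ₖ Kernel.const E ρ) := by
  have := Measure.isProbabilityMeasure_map (μ := m) hD.aemeasurable
  have hg : Measurable fun z : X × Y => (D z.1, z) := by fun_prop
  ext s hs
  have hs' : MeasurableSet {p : (E × X) × Y | (p.1.1, (p.1.2, p.2)) ∈ s} := by
    have : Measurable fun p : (E × X) × Y => (p.1.1, (p.1.2, p.2)) := by fun_prop
    exact this hs
  have hf : Measurable fun p : E × X => ρ {u | (p.1, (p.2, u)) ∈ s} :=
    measurable_measure_prodMk_left hs'
  calc (m.prod ρ).map (fun z => (D z.1, z)) s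
      = ∫⁻ x, ρ {u | (D x, (x, u)) ∈ s} ∂m := by
        rw [Measure.map_apply hg hs, Measure.prod_apply (hg hs)]; rfl
    _ = ∫⁻ p, ρ {u | (p.1, (p.2, u)) ∈ s} ∂(m.map fun x => (D x, id x)) := by
        rw [lintegral_map hf (by fun_prop)]; rfl
    _ = ∫⁻ ω, ∫⁻ x, ρ {u | (ω, (x, u)) ∈ s} ∂(condDistrib id D m ω) ∂(m.map D) := by
        rw [← compProd_map_condDistrib aemeasurable_id, Measure.lintegral_compProd hf]
    _ = _ := by
        rw [Measure.compProd_apply hs]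
        refine lintegral_congr fun ω => ?_
        rw [Kernel.prod_apply, Kernel.const_apply,
          Measure.prod_apply (measurable_prodMk_left hs)]
        rfl

set_option maxHeartbeats 1000000 in
/-- After multiplying by `[0,1)`, every measurable map out of a standard Borel probability space
becomes, up to an isomorphism mod 0, the projection of its law times `[0,1)`. -/
theorem exists_isModZeroIso_fst_eq [StandardBorelSpace X] [StandardBorelSpace E]
    (m : Measure X) [IsProbabilityMeasure m] {D : X → E} (hD : Measurable D) :
    ∃ Φ : X × Ico (0 : ℝ) 1 → E × Ico (0 : ℝ) 1,
      IsModZeroIso (withCasino m) (withCasino (m.map D)) Φ ∧ ∀ z, (Φ z).1 = D z.1 := by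
  have : Nonempty X := nonempty_of_isProbabilityMeasure m
  have : Nonempty (Ico (0 : ℝ) 1) := ⟨0, by simp⟩
  have : StandardBorelSpace (Ico (0 : ℝ) 1) := measurableSet_Ico.standardBorel
  have : IsProbabilityMeasure (m.map D) := Measure.isProbabilityMeasure_map hD.aemeasurable
  let ρ : Measure (Ico (0 : ℝ) 1) := volume.comap Subtype.val
  have hρ : NullSingletonClass ρ := ⟨fun x => by
    rw [comap_subtype_coe_apply measurableSet_Ico]; simp⟩
  -- The conditional law of `(x, u)` given `D x = ω`; the Lebesgue factor removes any atoms.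
  let η : Kernel E (X × Ico (0 : ℝ) 1) := condDistrib id D m ×ₖ Kernel.const E ρ
  let e := embeddingReal (X × Ico (0 : ℝ) 1)
  have he : MeasurableEmbedding e := measurableEmbedding_embeddingReal _
  let ξ : Kernel E ℝ := η.map e
  have hξM : IsMarkovKernel ξ := Kernel.IsMarkovKernel.map _ he.measurable
  have hξ : ∀ ω, ξ ω = (η ω).map e := Kernel.map_apply _ he.measurable
  have hηs : ∀ ω z, η ω {z} = 0 := by
    intro ω z
    rw [Kernel.prod_apply, Kernel.const_apply, ← singleton_prod_singleton, Measure.prod_prod,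
      measure_singleton (μ := ρ), mul_zero]
  have hξs : ∀ ω, NullSingletonClass (ξ ω) := by
    refine fun ω => ⟨fun y => ?_⟩
    rw [hξ, Measure.map_apply he.measurable (measurableSet_singleton y)]
    rcases (e ⁻¹' {y}).eq_empty_or_nonempty with h | ⟨z, hz⟩
    · rw [h, measure_empty]
    · refine measure_mono_null (fun z' hz' => he.injective ?_) (hηs ω z)
      exact (mem_singleton_iff.1 hz').trans (mem_singleton_iff.1 hz).symm
  have hF := measurable_cdf_kernel ξ
  have hlaw := map_prodMk_prod_eq_compProd m ρ hD
  let G : E × (X × Ico (0 : ℝ) 1) → E × Ico (0 : ℝ) 1 :=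
    fun p => (p.1, fractIco (cdf (ξ p.1) (e p.2)))
  have hem : Measurable e := he.measurable
  have hFe : Measurable fun p : E × (X × Ico (0 : ℝ) 1) => cdf (ξ p.1) (e p.2) :=
    hF.comp (by fun_prop : Measurable fun p : E × (X × Ico (0 : ℝ) 1) => (p.1, e p.2))
  have hFω : ∀ ω, Measurable fun z => cdf (ξ ω) (e z) := fun ω =>
    hFe.comp measurable_prodMk_left
  have hG : Measurable G := measurable_fst.prodMk (measurable_fractIco.comp hFe)
  have hg : Measurable fun z : X × Ico (0 : ℝ) 1 => (D z.1, z) := by fun_prop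
  have hunif : ∀ ω, ((η ω).map fun z => cdf (ξ ω) (e z)) = volume.restrict (Ico 0 1) := by
    intro ω
    have := hξs ω
    have h := map_cdf_eq_volume_restrict (ξ ω)
    rwa [show (ξ ω).map (cdf (ξ ω)) = ((η ω).map e).map (cdf (ξ ω)) by rw [← hξ],
      Measure.map_map (continuous_cdf _).measurable hem] at h
  have hmp : MeasurePreserving (fun z => G (D z.1, z)) (withCasino m) (withCasino (m.map D)) := by
    refine ⟨hG.comp hg, ?_⟩
    change (m.prod ρ).map (G ∘ fun z => (D z.1, z)) = (m.map D).prod ρ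
    rw [← Measure.map_map hG hg, hlaw]
    ext A hA
    rw [Measure.map_apply hG hA, Measure.compProd_apply (hG hA), Measure.prod_apply hA]
    refine lintegral_congr fun ω => ?_
    have hAω : MeasurableSet (Prod.mk ω ⁻¹' A) := measurable_prodMk_left hA
    change η ω ((fun z => cdf (ξ ω) (e z)) ⁻¹' (fractIco ⁻¹' (Prod.mk ω ⁻¹' A))) = ρ _
    rw [← Measure.map_apply (hFω ω) (measurable_fractIco hAω), hunif,
      ← Measure.map_apply measurable_fractIco hAω, map_fractIco]
  -- Two points over the same `ω` with equal cdf values but distinct embeddings have a rational `q`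
  -- between them, where the cdf takes that same value. Discarding these countably many levels gives
  -- injectivity; discarding level `1` makes `fractIco` act as the identity.
  let S : Set (E × (X × Ico (0 : ℝ) 1)) :=
    {p | cdf (ξ p.1) (e p.2) ≠ 1} ∩ ⋂ q : ℚ, {p | cdf (ξ p.1) (e p.2) ≠ cdf (ξ p.1) q}
  have hS : MeasurableSet S := by
    refine (measurableSet_eq_fun hFe measurable_const).compl.inter (MeasurableSet.iInter fun q =>
      (measurableSet_eq_fun hFe ?_).compl)
    exact hF.comp (by fun_prop : Measurable fun p : E × (X × Ico (0 : ℝ) 1) => (p.1, (q : ℝ)))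
  have hS0 : (withCasino m) ((fun z => (D z.1, z)) ⁻¹' S)ᶜ = 0 := by
    change (m.prod ρ) ((fun z => (D z.1, z)) ⁻¹' Sᶜ) = 0
    rw [← Measure.map_apply hg hS.compl, hlaw, Measure.compProd_apply hS.compl]
    refine lintegral_eq_zero_of_ae_eq_zero (Eventually.of_forall fun ω => ?_)
    have hlev : ∀ c, η ω {z | cdf (ξ ω) (e z) = c} = 0 := by
      intro c
      have : {z | cdf (ξ ω) (e z) = c} = (fun z => cdf (ξ ω) (e z)) ⁻¹' {c} := rfl
      rw [this, ← Measure.map_apply (hFω ω) (measurableSet_singleton c),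
        hunif]
      simp
    have : Prod.mk ω ⁻¹' Sᶜ ⊆ {z | cdf (ξ ω) (e z) = 1} ∪
        ⋃ q : ℚ, {z | cdf (ξ ω) (e z) = cdf (ξ ω) q} := by
      intro z hz
      by_contra hcon
      refine hz ⟨fun h => hcon (Or.inl h), mem_iInter.2 fun q h => hcon (Or.inr ?_)⟩
      exact mem_iUnion.2 ⟨q, h⟩
    exact measure_mono_null this (measure_union_null (hlev 1) (measure_iUnion_null fun q => hlev _))
  refine ⟨_, IsModZeroIso.of_injOn hmp (hg hS) hS0 ?_, fun z => rfl⟩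
  have hfr : ∀ z, (D z.1, z) ∈ S →
      (fractIco (cdf (ξ (D z.1)) (e z)) : ℝ) = cdf (ξ (D z.1)) (e z) := fun z hz =>
    Int.fract_eq_self.2 ⟨cdf_nonneg _ _, lt_of_le_of_ne (cdf_le_one _ _) hz.1⟩
  have hlt : ∀ z z', (D z.1, z) ∈ S → (D z'.1, z') ∈ S → D z.1 = D z'.1 → e z < e z' →
      cdf (ξ (D z.1)) (e z) ≠ cdf (ξ (D z'.1)) (e z') := by
    intro z z' hz _ hDD hlt heq
    obtain ⟨q, hq1, hq2⟩ := exists_rat_btwn hlt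
    refine mem_iInter.1 hz.2 q (le_antisymm (monotone_cdf _ hq1.le) ?_)
    rw [heq, ← hDD]
    exact monotone_cdf _ hq2.le
  intro z hz z' hz' hzz
  have hDD : D z.1 = D z'.1 := congrArg Prod.fst hzz
  have hcdf : cdf (ξ (D z.1)) (e z) = cdf (ξ (D z'.1)) (e z') := by
    rw [← hfr z hz, ← hfr z' hz']
    exact congrArg (fun p : E × Ico (0 : ℝ) 1 => (p.2 : ℝ)) hzz
  rcases lt_trichotomy (e z) (e z') with h | h | h
  · exact absurd hcdf (hlt z z' hz hz' hDD h)
  · exact he.injective h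
  · exact absurd hcdf.symm (hlt z' z hz' hz hDD.symm h)

end ConditionalUniformization


/-! ### Densities under mod 0 isomorphisms. -/

section Density

variable {α β : Type*} [MeasurableSpace α] [MeasurableSpace β] {μ : Measure α} {ν : Measure β}

theorem NullMeasurePreserving.withDensity [MeasurableSpace.CountablyGenerated β] {φ : α → β}
    (hφ : NullMeasurePreserving φ μ ν) {f : α → ℝ≥0∞} {g : β → ℝ≥0∞} (hg : Measurable g)
    (hfg : f =ᵐ[μ] g ∘ φ) :
    NullMeasurePreserving φ (μ.withDensity f) (ν.withDensity g) := by
  have hac := withDensity_absolutelyContinuous μ f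
  refine ⟨fun U hU => (hφ.nullMeasurable hU).mono_ac hac, fun U hU => ?_⟩
  rw [withDensity_apply₀ _ (hφ.nullMeasurable hU), withDensity_apply _ hU, ← hφ.map_eq,
    Measure.restrict_map_of_aemeasurable hφ.aemeasurable hU,
    lintegral_map' hg.aemeasurable (hφ.aemeasurable.mono_measure Measure.restrict_le_self)]
  exact lintegral_congr_ae (ae_restrict_of_ae hfg)

theorem IsModZeroIso.withDensity [Nonempty α] [MeasurableSpace.CountablyGenerated β] {φ : α → β}
    (hφ : IsModZeroIso μ ν φ) {f : α → ℝ≥0∞} {g : β → ℝ≥0∞} (hg : Measurable g)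
    (hfg : f =ᵐ[μ] g ∘ φ) : IsModZeroIso (μ.withDensity f) (ν.withDensity g) φ := by
  obtain ⟨ψ, h1, h2, h3, h4⟩ := isModZeroIso_iff.1 hφ
  have hf := withDensity_absolutelyContinuous μ f
  have hg' := withDensity_absolutelyContinuous ν g
  have h := h1.withDensity hg hfg
  exact isModZeroIso_iff.2 ⟨ψ, h, h.symm (fun V hV => (h2.nullMeasurable hV).mono_ac hg')
    (hf.ae_le h3), hf.ae_le h3, hg'.ae_le h4⟩

/-- Up to a null set every measurable `V` is a preimage under `φ`, namely of `ψ ⁻¹' V`, so `f` and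
`g ∘ φ` have the same integral over every such `V`. -/
theorem IsModZeroIso.ae_eq_comp_of_withDensity [Nonempty α] [SigmaFinite μ]
    [MeasurableSpace.CountablyGenerated β] {φ : α → β}
    (hφ : IsModZeroIso μ ν φ) {f : α → ℝ≥0∞} {g : β → ℝ≥0∞} (hf : AEMeasurable f μ)
    (hg : Measurable g) (h : IsModZeroIso (μ.withDensity f) (ν.withDensity g) φ) :
    f =ᵐ[μ] g ∘ φ := by
  obtain ⟨ψ, h1, h2, h3, h4⟩ := isModZeroIso_iff.1 hφ
  obtain ⟨-, k1, -⟩ := isModZeroIso_iff.1 h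
  have hgφ := h1.withDensity hg (Eventually.of_forall fun _ => rfl)
  refine ae_eq_of_forall_setLIntegral_eq_of_sigmaFinite₀ hf
    (hg.comp_aemeasurable h1.aemeasurable) fun V hV _ => ?_
  have e : (φ ⁻¹' (ψ ⁻¹' V) : Set α) =ᵐ[μ] V := by
    filter_upwards [h3] with x hx
    change (ψ (φ x) ∈ V) = (x ∈ V)
    rw [hx]
  have hW : NullMeasurableSet (ψ ⁻¹' V) (ν.withDensity g) :=
    (h2.nullMeasurable hV).mono_ac (withDensity_absolutelyContinuous ν g)
  rw [← withDensity_apply f hV, ← withDensity_apply (g ∘ φ) hV,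
    ← measure_congr ((withDensity_absolutelyContinuous μ f).ae_le e),
    ← measure_congr ((withDensity_absolutelyContinuous μ (g ∘ φ)).ae_le e),
    k1.measure_preimage₀ hW, hgφ.measure_preimage₀ hW]

theorem withCasino_withDensity [SFinite μ] {f : α → ℝ≥0∞} (hf : Measurable f) :
    withCasino (μ.withDensity f) = (withCasino μ).withDensity fun z => f z.1 :=
  prod_withDensity_left hf

end Density

/-! ### Existence and uniqueness of the joint isomorphism. -/

section JointIsomorphism

variable {Ω : Type*} [MeasurableSpace Ω] {n : ℕ} {P₀ : Measure Ω} {P : Fin n → Measure Ω}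
  {D : Ω → PosOrthant n}

theorem measurable_ofReal_coord (i : Fin n) :
    Measurable fun ω : PosOrthant n => ENNReal.ofReal (ω i : ℝ) := by
  fun_prop

theorem exists_measurable_density_vector [IsFiniteMeasure P₀] [∀ i, IsFiniteMeasure (P i)]
    (hequiv : ∀ i, P i ≪ P₀ ∧ P₀ ≪ P i) :
    ∃ D : Ω → PosOrthant n, Measurable D ∧
      (∀ i, P i = P₀.withDensity fun x => ENNReal.ofReal (D x i : ℝ)) ∧
      (fun x i => (D x i : ℝ)) =ᵐ[P₀] fun x i => ((P i).rnDeriv P₀ x).toReal := by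
  classical
  let r : Fin n → Ω → ℝ := fun i x => ((P i).rnDeriv P₀ x).toReal
  have hr : ∀ i, Measurable (r i) := fun i => ((P i).measurable_rnDeriv P₀).ennreal_toReal
  -- The value `1` is used where the derivative is `0` or `∞`, a `P₀`-null set by equivalence and
  -- finiteness; this puts `D` in the open orthant everywhere.
  let d : Fin n → Ω → ℝ := fun i x => if 0 < r i x then r i x else 1
  have hd0 : ∀ i x, 0 < d i x := fun i x => by
    by_cases h : 0 < r i x <;> simp [d, h]
  have hdm : ∀ i, Measurable (d i) := fun i =>
    Measurable.ite (measurableSet_lt measurable_const (hr i)) (hr i) measurable_const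
  have hdr : ∀ i, ∀ᵐ x ∂P₀, d i x = r i x ∧ (P i).rnDeriv P₀ x ≠ ∞ := fun i => by
    filter_upwards [Measure.rnDeriv_pos' (hequiv i).2, (P i).rnDeriv_lt_top P₀] with x h1 h2
    have : 0 < r i x := ENNReal.toReal_pos h1.ne' h2.ne
    exact ⟨by simp [d, this], h2.ne⟩
  refine ⟨fun x i => ⟨d i x, hd0 i x⟩,
    measurable_pi_iff.2 fun i => (hdm i).subtype_mk, fun i => ?_, ?_⟩
  · conv_lhs => rw [← Measure.withDensity_rnDeriv_eq _ _ (hequiv i).1]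
    refine withDensity_congr_ae ?_
    filter_upwards [hdr i] with x hx
    rw [hx.1, ENNReal.ofReal_toReal hx.2]
  · filter_upwards [ae_all_iff.2 hdr] with x hx
    exact funext fun i => (hx i).1

theorem jointlyModZeroIsomorphic_map [IsProbabilityMeasure P₀] (hstd : IsStandardProb P₀)
    (hD : Measurable D) (hP : ∀ i, P i = P₀.withDensity fun x => ENNReal.ofReal (D x i : ℝ)) :
    JointlyModZeroIsomorphic P₀ P (P₀.map D) := by
  have : Nonempty Ω := nonempty_of_isProbabilityMeasure P₀
  have : Nonempty (Ico (0 : ℝ) 1) := ⟨0, by simp⟩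
  have : StandardBorelSpace (Ico (0 : ℝ) 1) := measurableSet_Ico.standardBorel
  have : StandardBorelSpace (Ioi (0 : ℝ)) := measurableSet_Ioi.standardBorel
  obtain ⟨a, w, -, φ, hφ⟩ := hstd
  obtain ⟨ψ, h1, h2, h3, h4⟩ := isModZeroIso_iff.1 hφ
  set m := lebesgueWithAtoms a w
  have hmP : IsProbabilityMeasure m := by
    rw [← h1.map_eq]; exact Measure.isProbabilityMeasure_map h1.aemeasurable
  -- On the standard Borel model the density vector is only almost everywhere measurable; a Borel
  -- version `D'` replaces it.
  have hDψ : AEMeasurable (D ∘ ψ) m :=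
    (hD.comp_nullMeasurable h2.nullMeasurable).aemeasurable
  obtain ⟨D', hD', hDD'⟩ := hDψ
  obtain ⟨Φ, hΦ, hΦ1⟩ := exists_isModZeroIso_fst_eq m hD'
  have hfst : (fun x => D' (φ x)) =ᵐ[P₀] D := by
    filter_upwards [h1.tendsto_ae.eventually hDD', h3] with x hx hx'
    rw [← hx, Function.comp_apply, hx']
  have hlaw : m.map D' = P₀.map D := by
    rw [← Measure.map_congr hfst, ← h1.map_eq,
      AEMeasurable.map_map_of_aemeasurable hD'.aemeasurable h1.aemeasurable]
    rfl
  rw [hlaw] at hΦ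
  have hiso := hΦ.comp hφ.prodMap_id
  refine ⟨_, hiso, fun i => ?_⟩
  rw [hP i, coordMeasure, withCasino_withDensity (by fun_prop),
    withCasino_withDensity (measurable_ofReal_coord i)]
  refine hiso.withDensity ((measurable_ofReal_coord i).comp measurable_fst) ?_
  filter_upwards [Measure.quasiMeasurePreserving_fst.ae hfst] with z hz
  simp only [Function.comp_apply, hΦ1, Prod.map_fst]
  rw [hz]

theorem JointlyModZeroIsomorphic.eq_map [IsProbabilityMeasure P₀] {ν : Measure (PosOrthant n)}
    [IsProbabilityMeasure ν] (h : JointlyModZeroIsomorphic P₀ P ν) (hD : Measurable D)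
    (hP : ∀ i, P i = P₀.withDensity fun x => ENNReal.ofReal (D x i : ℝ)) : ν = P₀.map D := by
  have : Nonempty Ω := nonempty_of_isProbabilityMeasure P₀
  have : Nonempty (Ico (0 : ℝ) 1) := ⟨0, by simp⟩
  obtain ⟨φ, hφ, hφi⟩ := h
  obtain ⟨-, h1, -⟩ := isModZeroIso_iff.1 hφ
  have hfst : (fun z => (φ z).1) =ᵐ[withCasino P₀] fun z => D z.1 := by
    have : ∀ i, ∀ᵐ z ∂(withCasino P₀), D z.1 i = (φ z).1 i := fun i => by
      have hi := hφi i
      rw [hP i, coordMeasure, withCasino_withDensity (by fun_prop),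
        withCasino_withDensity (measurable_ofReal_coord i)] at hi
      filter_upwards [hφ.ae_eq_comp_of_withDensity (by fun_prop)
        ((measurable_ofReal_coord i).comp measurable_fst) hi] with z hz
      exact Subtype.ext ((ENNReal.ofReal_eq_ofReal_iff (D z.1 i).2.le ((φ z).1 i).2.le).1 hz)
    filter_upwards [ae_all_iff.2 this] with z hz
    exact funext fun i => (hz i).symm
  calc ν = (withCasino ν).map Prod.fst := by rw [withCasino, Measure.map_fst_prod]; simp
    _ = (withCasino P₀).map fun z => (φ z).1 := by
      rw [← h1.map_eq, AEMeasurable.map_map_of_aemeasurable measurable_fst.aemeasurable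
        h1.aemeasurable]
      rfl
    _ = (withCasino P₀).map (D ∘ Prod.fst) := Measure.map_congr hfst
    _ = P₀.map D := by
      rw [← Measure.map_map hD measurable_fst, withCasino, Measure.map_fst_prod]; simp

end JointIsomorphism

theorem mainTheorem3 {Ω : Type*} [MeasurableSpace Ω] (n : ℕ)
    (P₀ : Measure Ω) (P : Fin n → Measure Ω)
    [IsProbabilityMeasure P₀] [∀ i, IsProbabilityMeasure (P i)]
    (hequiv : ∀ i, P i ≪ P₀ ∧ P₀ ≪ P i)
    (hstd : IsStandardProb P₀) :
    (∃! ν : Measure (PosOrthant n),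
      IsProbabilityMeasure ν ∧ JointlyModZeroIsomorphic P₀ P ν) ∧
    ∀ ν : Measure (PosOrthant n),
      IsProbabilityMeasure ν → JointlyModZeroIsomorphic P₀ P ν →
        ν.map (fun ω (i : Fin n) => (ω i : ℝ)) =
            P₀.map (fun x (i : Fin n) => ((P i).rnDeriv P₀ x).toReal) ∧
        ∀ i, Integrable (fun ω : PosOrthant n => (ω i : ℝ)) ν ∧ ∫ ω, (ω i : ℝ) ∂ν = 1 ∧
          IsProbabilityMeasure (coordMeasure ν i) := by
  obtain ⟨D, hD, hP, hDr⟩ := exists_measurable_density_vector hequiv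
  refine ⟨⟨P₀.map D, ⟨Measure.isProbabilityMeasure_map hD.aemeasurable,
    jointlyModZeroIsomorphic_map hstd hD hP⟩, fun ν ⟨_, hν⟩ => hν.eq_map hD hP⟩, ?_⟩
  intro ν _ hν
  have hνD := hν.eq_map hD hP
  refine ⟨?_, fun i => ?_⟩
  · rw [hνD, Measure.map_map (by fun_prop) hD]
    exact Measure.map_congr hDr
  · have hone : ∫⁻ ω, ENNReal.ofReal (ω i : ℝ) ∂ν = 1 := by
      rw [hνD, lintegral_map (measurable_ofReal_coord i) hD, ← setLIntegral_univ,
        ← withDensity_apply _ MeasurableSet.univ, ← hP i, measure_univ]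
    have hpos : 0 ≤ᵐ[ν] fun ω : PosOrthant n => (ω i : ℝ) :=
      Eventually.of_forall fun ω => (ω i).2.le
    have hm : AEStronglyMeasurable (fun ω : PosOrthant n => (ω i : ℝ)) ν :=
      Measurable.aestronglyMeasurable (by fun_prop)
    refine ⟨⟨hm, ?_⟩, ?_, ⟨?_⟩⟩
    · rw [hasFiniteIntegral_iff_ofReal hpos, hone]
      exact ENNReal.one_lt_top
    · rw [integral_eq_lintegral_of_nonneg_ae hpos hm, hone, ENNReal.toReal_one]
    · rw [coordMeasure, withDensity_apply _ MeasurableSet.univ, setLIntegral_univ, hone]
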